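/- Fix an odd prime $p$ and let $c\in\mathbb{Q}$. Put $f_c(x)=x^2+c$, and let $\mathrm{PrePer}(f_c)$ be the set of all $\alpha\in\overline{\mathbb{Q}}$ such that $f_c^n(\alpha)=f_c^m(\alpha)$ for some integers $0\le m<n$, where $f_c^n$ denotes the $n$-fold composition of $f_c$ with itself. Let $\mathbb{Q}^{\mathrm{tp}}$ be the set of all totally $p$-adic algebraic numbers, that is, of all $\alpha\in\overline{\mathbb{Q}}$ whose minimal polynomial over $\mathbb{Q}$ splits completely over $\mathbb{Q}_p$. (a) If $|c|_p\le 1$, then $\mathrm{PrePer}(f_c)\cap\mathbb{Q}^{\mathrm{tp}}$ is finite. (b) If $|c|_p>1$ and $-c$ is not a square in $\mathbb{Q}_p$, then $\mathrm{PrePer}(f_c)\cap\mathbb{Q}^{\mathrm{tp}}$ is empty. (c) If $|c|_p>1$ and $-c$ is a square in $\mathbb{Q}_p$, then $\mathrm{PrePer}(f_c)\subset\mathbb{Q}^{\mathrm{tp}}$; in particular, $\mathrm{PrePer}(f_c)$ contains infinitely many totally $p$-adic points. -/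

import Mathlib

/-- The quadratic map `f_c(x) = x ^ 2 + c` on the algebraic closure of `ℚ`, for rational `c`. -/
noncomputable def quadMap (c : ℚ) (x : AlgebraicClosure ℚ) : AlgebraicClosure ℚ :=
  x ^ 2 + algebraMap ℚ (AlgebraicClosure ℚ) c

/-- The set of all preperiodic points of `f_c` in the algebraic closure of `ℚ`. -/
def prePer (c : ℚ) : Set (AlgebraicClosure ℚ) :=
  {α | ∃ m n : ℕ, m < n ∧ (quadMap c)^[n] α = (quadMap c)^[m] α}

/-- The set of all totally `p`-adic algebraic numbers: those whose minimal polynomial over `ℚ`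
splits completely over `ℚ_p`. -/
def totallyPadic (p : ℕ) [Fact p.Prime] : Set (AlgebraicClosure ℚ) :=
  {α | ((minpoly ℚ α).map (algebraMap ℚ ℚ_[p])).Splits}

open Polynomial

/-!
Write `f x = x ^ 2 + c`. The three cases are settled by where preperiodic points can lie
`p`-adically, after embedding `AlgebraicClosure ℚ` into an algebraic closure of `ℚ_[p]`.

If `1 < ‖c‖`, every preperiodic point lies on the circle `‖x‖ ^ 2 = ‖c‖`, since all other points
escape (`IsPreperiodicPt.norm_sq_eq`). For such a point `y` in `ℚ_[p]` the quotient `f y / y ^ 2` has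
norm less than one, so that `-c = y ^ 2 * (1 - f y / y ^ 2)` is a square by Hensel's lemma
(`IsPreperiodicPt.isSquare_neg`). Conversely, if `-c = s ^ 2` with `s` in `ℚ_[p]`, then the filled
Julia set lies in two small discs about `s` and `-s`, each of which is Galois-stable and is expanded
by `f` by the factor `‖s‖ > 1`; hence a Galois automorphism, being an isometry and commuting with
`f`, fixes every preperiodic point (`IsPreperiodicPt.galois_fixed`).

If `‖c‖ ≤ 1`, the totally `p`-adic preperiodic points lie in `ℤ_[p]`, whose capacity is less than
one, while the other local filled Julia sets have capacity one, and finiteness is a theorem of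
Fekete type. It is proved through the Vandermonde determinant `V` of a finite Galois-stable set of
`N` such points. Up to a power of the denominator of `c`, `V ^ 2` is a nonzero integer, so that its
absolute value times its `p`-adic norm is at least one. A Vandermonde determinant may be computed in
any basis of monic polynomials of degrees `0, …, N - 1`. Products of iterates of `f`, one for each
set of binary digits, have at most about `log₂ N` factors, each bounded on preperiodic points; so
both the denominator and `|V|` are at most `exp (O (N log N))`. The polynomials
`(X ^ p - X) ^ (j / p) * X ^ (j % p)` are divisible by `p ^ (j / p)` on `ℤ_[p]`, so the `p`-adic norm
of `V` is at most about `p ^ (-N ^ 2 / (2 * p))` (`pow_sum_div_le`). These bounds are incompatible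
for large `N` (`exists_forall_lt_pow_sum_div`).
-/

/-! ### Preperiodic points of quadratic maps -/

/-- The map `x ↦ x ^ 2 + c` on a commutative ring. -/
def quadraticMap {R : Type*} [CommRing R] (c x : R) : R := x ^ 2 + c

/-- A point whose forward orbit under `f` revisits one of its points. -/
def IsPreperiodicPt {X : Type*} (f : X → X) (x : X) : Prop :=
  ∃ m n : ℕ, m < n ∧ f^[n] x = f^[m] x

theorem mem_prePer_iff {c : ℚ} {α : AlgebraicClosure ℚ} :
    α ∈ prePer c ↔ IsPreperiodicPt (quadraticMap (algebraMap ℚ (AlgebraicClosure ℚ) c)) α :=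
  Iff.rfl

theorem IsPreperiodicPt.iterate {X : Type*} {f : X → X} {x : X} (h : IsPreperiodicPt f x)
    (k : ℕ) : IsPreperiodicPt f (f^[k] x) := by
  obtain ⟨m, n, hmn, h⟩ := h
  refine ⟨m, n, hmn, ?_⟩
  rw [← Function.iterate_add_apply, ← Function.iterate_add_apply, add_comm n, add_comm m,
    Function.iterate_add_apply, Function.iterate_add_apply, h]

theorem IsPreperiodicPt.of_apply {X : Type*} {f : X → X} {x : X} (h : IsPreperiodicPt f (f x)) :
    IsPreperiodicPt f x := by
  obtain ⟨m, n, hmn, h⟩ := h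
  exact ⟨m + 1, n + 1, by omega, by simpa only [Function.iterate_succ_apply] using h⟩

/-- A preperiodic point avoids every invariant region on which some real function strictly
increases along `f`. -/
theorem IsPreperiodicPt.not_of_lt {X : Type*} {f : X → X} {x : X} (h : IsPreperiodicPt f x)
    (P : X → Prop) (g : X → ℝ) (hP : ∀ y, P y → P (f y) ∧ g y < g (f y)) : ¬ P x := by
  intro hx
  obtain ⟨m, n, hmn, h⟩ := h
  have hall : ∀ k, P (f^[k] x) := by
    intro k
    induction k with
    | zero => exact hx
    | succ k ih => rw [Function.iterate_succ_apply']; exact (hP _ ih).1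
  have hmono : StrictMono fun k => g (f^[k] x) := strictMono_nat_of_lt_succ fun k => by
    rw [Function.iterate_succ_apply']; exact (hP _ (hall k)).2
  exact (hmono hmn).ne (by simp only [h])

theorem iterate_quadraticMap_map {R S : Type*} [CommRing R] [CommRing S] (φ : R →+* S) (c x : R)
    (k : ℕ) : φ ((quadraticMap c)^[k] x) = (quadraticMap (φ c))^[k] (φ x) := by
  induction k with
  | zero => rfl
  | succ k ih =>
    rw [Function.iterate_succ_apply', Function.iterate_succ_apply', ← ih]
    simp [quadraticMap]

theorem IsPreperiodicPt.map {R S : Type*} [CommRing R] [CommRing S] (φ : R →+* S) {c x : R}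
    (h : IsPreperiodicPt (quadraticMap c) x) : IsPreperiodicPt (quadraticMap (φ c)) (φ x) := by
  obtain ⟨m, n, hmn, h⟩ := h
  exact ⟨m, n, hmn, by rw [← iterate_quadraticMap_map, ← iterate_quadraticMap_map, h]⟩

/-- The polynomial giving the `n`-th iterate of `x ↦ x ^ 2 + c`. -/
noncomputable def iterPoly {R : Type*} [CommRing R] (c : R) : ℕ → R[X]
  | 0 => X
  | n + 1 => iterPoly c n ^ 2 + C c

theorem aeval_iterPoly {R A : Type*} [CommRing R] [CommRing A] [Algebra R A] (c : R) (x : A)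
    (n : ℕ) : aeval x (iterPoly c n) = (quadraticMap (algebraMap R A c))^[n] x := by
  induction n with
  | zero => simp [iterPoly]
  | succ n ih => rw [Function.iterate_succ_apply', ← ih]; simp [iterPoly, quadraticMap]

theorem iterPoly_monic_natDegree {R : Type*} [CommRing R] [Nontrivial R] (c : R) (n : ℕ) :
    (iterPoly c n).Monic ∧ (iterPoly c n).natDegree = 2 ^ n := by
  induction n with
  | zero => simp [iterPoly, monic_X]
  | succ n ih =>
    have hm : (iterPoly c n ^ 2).Monic := ih.1.pow 2
    have hd : (iterPoly c n ^ 2).natDegree = 2 ^ (n + 1) := by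
      rw [ih.1.natDegree_pow, ih.2, pow_succ]; ring
    have hlt : (C c : R[X]).degree < (iterPoly c n ^ 2).degree := by
      refine degree_C_le.trans_lt ?_
      rw [degree_eq_natDegree hm.ne_zero, hd]
      exact_mod_cast Nat.two_pow_pos _
    refine ⟨hm.add_of_left hlt, ?_⟩
    rw [iterPoly, natDegree_add_eq_left_of_degree_lt hlt, hd]

/-- Algebraicity for the `ℚ`-algebra structure that instance search finds on
`AlgebraicClosure ℚ`, namely the one of a division ring of characteristic zero. -/
instance algebraicClosureRat_isAlgebraic : Algebra.IsAlgebraic ℚ (AlgebraicClosure ℚ) :=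
  AlgebraicClosure.isAlgebraic ℚ

instance algebraicClosureRat_isGalois : IsGalois ℚ (AlgebraicClosure ℚ) where
  to_normal := normal_iff.2 fun x => ⟨Algebra.IsIntegral.isIntegral x, IsAlgClosed.splits _⟩

/-- Conjugates of a preperiodic point are preperiodic. -/
theorem IsPreperiodicPt.of_aeval_minpoly {c : ℚ} {α : AlgebraicClosure ℚ} (h : α ∈ prePer c)
    {K : Type*} [Field K] [Algebra ℚ K] {β : K} (hβ : aeval β (minpoly ℚ α) = 0) :
    IsPreperiodicPt (quadraticMap (algebraMap ℚ K c)) β := by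
  obtain ⟨m, n, hmn, h⟩ := mem_prePer_iff.1 h
  refine ⟨m, n, hmn, ?_⟩
  have hdvd : minpoly ℚ α ∣ iterPoly c n - iterPoly c m :=
    minpoly.dvd _ _ (by rw [map_sub, aeval_iterPoly, aeval_iterPoly, h, sub_self])
  have := aeval_eq_zero_of_dvd_aeval_eq_zero hdvd hβ
  rwa [map_sub, aeval_iterPoly, aeval_iterPoly, sub_eq_zero] at this

/-- If `b` is the denominator of `c`, then `b * x` is integral for every preperiodic `x`: the
rescaled iterates `b ^ (2 ^ n) * f ^ n (y / b)` are monic integer polynomials in `y = b * x`. -/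
theorem IsPreperiodicPt.isIntegral_den_mul {c : ℚ} {K : Type*} [Field K] [CharZero K] {x : K}
    (h : IsPreperiodicPt (quadraticMap (c : K)) x) : IsIntegral ℤ ((c.den : K) * x) := by
  obtain ⟨m, n, hmn, h⟩ := h
  have hc : (c.den : K) * (c : K) = c.num := by
    exact_mod_cast congrArg (Rat.cast : ℚ → K) (Rat.den_mul_eq_num c)
  have key : ∀ k, ∃ G : ℤ[X], G.Monic ∧ G.natDegree = 2 ^ k ∧
      aeval ((c.den : K) * x) G = (c.den : K) ^ 2 ^ k * (quadraticMap (c : K))^[k] x := by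
    intro k
    induction k with
    | zero => exact ⟨X, monic_X, by simp, by simp⟩
    | succ k ih =>
      obtain ⟨G, hm, hd, hG⟩ := ih
      have hm' : (G ^ 2).Monic := hm.pow 2
      have hd' : (G ^ 2).natDegree = 2 ^ (k + 1) := by rw [hm.natDegree_pow, hd, pow_succ]; ring
      let e : ℤ := c.num * (c.den : ℤ) ^ (2 ^ (k + 1) - 1)
      have hlt : (C e : ℤ[X]).degree < (G ^ 2).degree := by
        refine degree_C_le.trans_lt ?_
        rw [degree_eq_natDegree hm'.ne_zero, hd']
        exact_mod_cast Nat.two_pow_pos _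
      refine ⟨G ^ 2 + C e, hm'.add_of_left hlt, by
        rw [natDegree_add_eq_left_of_degree_lt hlt, hd'], ?_⟩
      have he : (e : K) = (c.den : K) ^ 2 ^ (k + 1) * c := by
        obtain ⟨t, ht⟩ : ∃ t, 2 ^ (k + 1) = t + 1 :=
          ⟨2 ^ (k + 1) - 1, (Nat.sub_add_cancel (Nat.two_pow_pos _)).symm⟩
        simp only [e, ht, Nat.add_sub_cancel]
        push_cast
        rw [← hc]; ring
      rw [Function.iterate_succ_apply', map_add, map_pow, hG, aeval_C, eq_intCast, he,
        quadraticMap, pow_succ 2 k, pow_mul]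
      ring
  obtain ⟨G, hGm, hGd, hG⟩ := key n
  obtain ⟨H, hHm, hHd, hH⟩ := key m
  have hlt : 2 ^ m < 2 ^ n := Nat.pow_lt_pow_right (by norm_num) hmn
  have hdeg : (C ((c.den : ℤ) ^ (2 ^ n - 2 ^ m)) * H).degree < G.degree := by
    rw [degree_C_mul (pow_ne_zero _ (by exact_mod_cast c.den_ne_zero)),
      degree_eq_natDegree hHm.ne_zero, degree_eq_natDegree hGm.ne_zero, hHd, hGd]
    exact_mod_cast hlt
  refine ⟨G - C ((c.den : ℤ) ^ (2 ^ n - 2 ^ m)) * H, hGm.sub_of_left hdeg, ?_⟩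
  change aeval _ _ = _
  rw [map_sub, map_mul, hG, hH, aeval_C, h, ← mul_assoc]
  simp [← pow_add, Nat.sub_add_cancel hlt.le]

/-! ### Size of preperiodic points -/

theorem IsPreperiodicPt.norm_le_one_add {K : Type*} [NormedField K] {c x : K}
    (h : IsPreperiodicPt (quadraticMap c) x) : ‖x‖ ≤ 1 + ‖c‖ := by
  refine not_lt.1 (h.not_of_lt (fun y => 1 + ‖c‖ < ‖y‖) norm fun y hy => ?_)
  have h1 : ‖y‖ ^ 2 - ‖c‖ ≤ ‖quadraticMap c y‖ := by
    have := norm_sub_norm_le (y ^ 2) (-c)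
    rwa [norm_neg, norm_pow, sub_neg_eq_add] at this
  have h2 : ‖y‖ < ‖quadraticMap c y‖ := by nlinarith [norm_nonneg c]
  exact ⟨hy.trans h2, h2⟩

section Ultrametric

variable {K : Type*} [NormedField K] [IsUltrametricDist K]

theorem IsPreperiodicPt.norm_le_one {c x : K} (hc : ‖c‖ ≤ 1)
    (h : IsPreperiodicPt (quadraticMap c) x) : ‖x‖ ≤ 1 := by
  refine not_lt.1 (h.not_of_lt (fun y => 1 < ‖y‖) norm fun y hy => ?_)
  have h1 : ‖quadraticMap c y‖ = ‖y‖ ^ 2 := by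
    have hlt : ‖c‖ < ‖y ^ 2‖ := by rw [norm_pow]; nlinarith
    rw [quadraticMap, IsUltrametricDist.norm_add_eq_max_of_norm_ne_norm hlt.ne',
      max_eq_left hlt.le, norm_pow]
  have h2 : ‖y‖ < ‖quadraticMap c y‖ := by rw [h1]; nlinarith
  exact ⟨hy.trans h2, h2⟩

/-- When `1 < ‖c‖`, every preperiodic point lies on the circle `‖x‖ ^ 2 = ‖c‖`: points outside it
escape, and points inside it are sent outside. -/
theorem IsPreperiodicPt.norm_sq_eq {c x : K} (hc : 1 < ‖c‖)
    (h : IsPreperiodicPt (quadraticMap c) x) : ‖x‖ ^ 2 = ‖c‖ := by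
  have hle : ∀ z, IsPreperiodicPt (quadraticMap c) z → ‖z‖ ^ 2 ≤ ‖c‖ := fun z hz => by
    refine not_lt.1 (hz.not_of_lt (fun y => ‖c‖ < ‖y‖ ^ 2) norm fun y hy => ?_)
    have h1 : ‖quadraticMap c y‖ = ‖y‖ ^ 2 := by
      have hlt : ‖c‖ < ‖y ^ 2‖ := by rwa [norm_pow]
      rw [quadraticMap, IsUltrametricDist.norm_add_eq_max_of_norm_ne_norm hlt.ne',
        max_eq_left hlt.le, norm_pow]
    have h2 : 1 < ‖y‖ := by nlinarith [norm_nonneg y]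
    have h3 : ‖y‖ < ‖quadraticMap c y‖ := by rw [h1]; nlinarith
    exact ⟨hy.trans (by gcongr), h3⟩
  refine le_antisymm (hle x h) (not_lt.1 fun hlt => ?_)
  have h1 : ‖quadraticMap c x‖ = ‖c‖ := by
    rw [← norm_pow] at hlt
    rw [quadraticMap, IsUltrametricDist.norm_add_eq_max_of_norm_ne_norm hlt.ne,
      max_eq_right hlt.le]
  have := hle _ (h.iterate 1)
  rw [Function.iterate_one, h1] at this
  nlinarith

end Ultrametric

/-! ### The case `1 < ‖c‖` -/

theorem Padic.norm_two_eq_one {p : ℕ} [Fact p.Prime] (hp : p ≠ 2) : ‖(2 : ℚ_[p])‖ = 1 := by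
  have : ¬ (p : ℤ) ∣ 2 := fun h => hp <|
    (Nat.prime_dvd_prime_iff_eq Fact.out Nat.prime_two).1 (by exact_mod_cast h)
  refine le_antisymm (Padic.norm_int_le_one 2) (not_lt.1 fun h => this ?_)
  exact (Padic.norm_intCast_lt_one_iff (k := 2)).1 (by exact_mod_cast h)

theorem Padic.isSquare_of_norm_sub_one_lt {p : ℕ} [Fact p.Prime] (hp : p ≠ 2) {u : ℚ_[p]}
    (hu : ‖u - 1‖ < 1) : IsSquare u := by
  have hu1 : ‖u‖ ≤ 1 := by
    have := IsUltrametricDist.norm_add_le_max (u - 1) 1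
    rw [sub_add_cancel, norm_one] at this
    exact this.trans (max_le hu.le le_rfl)
  let w : ℤ_[p] := ⟨u, hu1⟩
  have h2 : ‖(2 : ℤ_[p])‖ = 1 := Padic.norm_two_eq_one hp
  have hw : ‖(1 : ℤ_[p]) - w‖ < 1 := by rw [norm_sub_rev]; exact hu
  obtain ⟨z, hz, -⟩ := hensels_lemma (p := p) (F := (X ^ 2 - C w : ℤ_[p][X])) (a := 1)
    (by simpa [h2, one_add_one_eq_two] using hw)
  refine ⟨z, ?_⟩
  have : w = z * z := by
    have := hz
    simp only [coe_aeval_eq_eval, eval_sub, eval_pow, eval_X, eval_C] at this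
    linear_combination -this
  exact congrArg (Subtype.val) this

/-- A preperiodic point `y` in `ℚ_[p]` makes `-c` a square, since `-c = y ^ 2 * (1 - f y / y ^ 2)`
and `f y / y ^ 2` has norm less than one. -/
theorem IsPreperiodicPt.isSquare_neg {p : ℕ} [Fact p.Prime] (hp : p ≠ 2) {c y : ℚ_[p]}
    (hc : 1 < ‖c‖) (h : IsPreperiodicPt (quadraticMap c) y) : IsSquare (-c) := by
  have hy := h.norm_sq_eq hc
  have hfy : ‖quadraticMap c y‖ ^ 2 = ‖c‖ := (h.iterate 1).norm_sq_eq hc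
  have hy0 : y ≠ 0 := by rintro rfl; simp at hy; linarith
  have hlt : ‖quadraticMap c y‖ < ‖y‖ ^ 2 := by
    rw [hy]; nlinarith [norm_nonneg (quadraticMap c y)]
  have hsq : IsSquare (1 - quadraticMap c y / y ^ 2) := by
    refine Padic.isSquare_of_norm_sub_one_lt hp ?_
    rw [sub_sub_cancel_left, norm_neg, norm_div, norm_pow]
    exact (div_lt_one (hlt.trans_le' (norm_nonneg _))).2 hlt
  have : -c = y * y * (1 - quadraticMap c y / y ^ 2) := by
    rw [quadraticMap]; field_simp; ring
  rw [this]
  exact (IsSquare.mul_self y).mul hsq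

/-- An embedding of `AlgebraicClosure ℚ` into an algebraic closure of `ℚ_[p]` sends totally
`p`-adic numbers into `ℚ_[p]`. -/
theorem map_mem_range_of_mem_totallyPadic {p : ℕ} [Fact p.Prime] {α : AlgebraicClosure ℚ}
    (h : α ∈ totallyPadic p) (φ : AlgebraicClosure ℚ →+* PadicAlgCl p) :
    ∃ y : ℚ_[p], algebraMap ℚ_[p] (PadicAlgCl p) y = φ α := by
  have hm : (minpoly ℚ α).Monic := minpoly.monic (Algebra.IsIntegral.isIntegral α)
  refine Splits.mem_range_of_isRoot h (hm.map _).ne_zero ?_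
  rw [IsRoot.def, Polynomial.map_map, eval_map,
    Subsingleton.elim ((algebraMap ℚ_[p] (PadicAlgCl p)).comp (algebraMap ℚ ℚ_[p]))
      (φ.comp (algebraMap ℚ (AlgebraicClosure ℚ))), ← hom_eval₂]
  simpa [aeval_def] using congrArg φ (minpoly.aeval ℚ α)

/-- If `-c` is not a square in `ℚ_[p]`, then `f` has no preperiodic point in `ℚ_[p]`, whereas
an embedding sends a totally `p`-adic preperiodic point to one. -/
theorem prePer_inter_totallyPadic_eq_empty {p : ℕ} [Fact p.Prime] (hp : p ≠ 2) {c : ℚ}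
    (hc : 1 < ‖(c : ℚ_[p])‖) (hsq : ¬ IsSquare (-(c : ℚ_[p]))) :
    prePer c ∩ totallyPadic p = ∅ := by
  refine Set.eq_empty_iff_forall_notMem.2 fun α hα => hsq ?_
  let ψ : AlgebraicClosure ℚ →+* PadicAlgCl p :=
    (IsAlgClosed.lift : AlgebraicClosure ℚ →ₐ[ℚ] PadicAlgCl p)
  obtain ⟨y, hy⟩ := map_mem_range_of_mem_totallyPadic hα.2 ψ
  obtain ⟨m, n, hmn, h⟩ := (mem_prePer_iff.1 hα.1).map ψ
  refine IsPreperiodicPt.isSquare_neg hp hc (y := y) ⟨m, n, hmn, ?_⟩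
  apply (algebraMap ℚ_[p] (PadicAlgCl p)).injective
  rw [iterate_quadraticMap_map, iterate_quadraticMap_map, hy, map_ratCast]
  simpa using h

/-- If `s ^ 2 = -c` and `‖s‖ > 1`, every orbit point `z` of a preperiodic `y` is closer than `‖s‖`
to `s` or `-s`, and so is its image `σ z`, on the same side. Hence `‖σ z + z‖ = ‖s‖`, and `f`
multiplies the distance between `z` and `σ z` by `‖s‖`. Orbits being bounded, `σ y = y`. -/
theorem IsPreperiodicPt.galois_fixed {p : ℕ} [Fact p.Prime] (hp : p ≠ 2) {s : ℚ_[p]}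
    (hs : 1 < ‖s‖) {y : PadicAlgCl p}
    (h : IsPreperiodicPt (quadraticMap (-(algebraMap ℚ_[p] (PadicAlgCl p) s) ^ 2)) y)
    (σ : PadicAlgCl p ≃ₐ[ℚ_[p]] PadicAlgCl p) : σ y = y := by
  set t : PadicAlgCl p := algebraMap ℚ_[p] (PadicAlgCl p) s
  have hts : ‖t‖ = ‖s‖ := PadicAlgCl.norm_extends p s
  have hσt : σ t = t := σ.commutes s
  have hσ : ∀ z, ‖σ z‖ = ‖z‖ := fun z => (spectralNorm_eq_of_equiv σ z).symm
  have h2 : ‖(2 : PadicAlgCl p)‖ = 1 := by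
    have := PadicAlgCl.norm_extends p (2 : ℚ_[p])
    rwa [map_ofNat, Padic.norm_two_eq_one hp] at this
  have hc : 1 < ‖-t ^ 2‖ := by rw [norm_neg, norm_pow, hts]; nlinarith
  -- Orbit points lie in the open discs of radius `‖s‖` about `s` and `-s`, hence so do conjugates.
  have hsum : ∀ z, IsPreperiodicPt (quadraticMap (-t ^ 2)) z → ‖σ z + z‖ = ‖s‖ := by
    intro z hz
    have hfz : ‖quadraticMap (-t ^ 2) z‖ = ‖s‖ := by
      have : ‖quadraticMap (-t ^ 2) z‖ ^ 2 = ‖s‖ ^ 2 := by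
        rw [← hts, ← norm_pow, ← norm_pow, ← norm_neg (t ^ 2), norm_pow]
        exact (hz.iterate 1).norm_sq_eq hc
      exact (pow_left_inj₀ (norm_nonneg _) (norm_nonneg _) two_ne_zero).1 this
    have hprod : ‖z - t‖ * ‖z + t‖ = ‖s‖ := by
      rw [← norm_mul, ← hfz, quadraticMap]; congr 1; ring
    have hclose : ∃ e : PadicAlgCl p, σ e = e ∧ ‖e‖ = ‖s‖ ∧ ‖z - e‖ < ‖s‖ := by
      rcases lt_or_ge ‖z - t‖ ‖s‖ with h1 | h1
      · exact ⟨t, hσt, hts, h1⟩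
      · refine ⟨-t, by rw [map_neg, hσt], by rw [norm_neg, hts], ?_⟩
        rw [sub_neg_eq_add]
        nlinarith [norm_nonneg (z + t)]
    obtain ⟨e, hσe, hes, hze⟩ := hclose
    have hσze : ‖σ z - e‖ < ‖s‖ := by
      have := hσ (z - e)
      rw [map_sub, hσe] at this
      rwa [this]
    have hlt : ‖(σ z - e) + (z - e)‖ < ‖2 * e‖ := by
      rw [norm_mul, h2, one_mul, hes]
      exact (IsUltrametricDist.norm_add_le_max _ _).trans_lt (max_lt hσze hze)
    have : σ z + z = ((σ z - e) + (z - e)) + 2 * e := by ring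
    rw [this, IsUltrametricDist.norm_add_eq_max_of_norm_ne_norm hlt.ne, max_eq_right hlt.le,
      norm_mul, h2, one_mul, hes]
  have hstep : ∀ k, ‖σ ((quadraticMap (-t ^ 2))^[k] y) - (quadraticMap (-t ^ 2))^[k] y‖
      = ‖s‖ ^ k * ‖σ y - y‖ := by
    intro k
    induction k with
    | zero => simp
    | succ k ih =>
      rw [Function.iterate_succ_apply', pow_succ' ‖s‖, mul_assoc, ← ih, ← hsum _ (h.iterate k),
        ← norm_mul]
      simp only [quadraticMap, map_add, map_neg, map_pow, hσt]
      congr 1; ring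
  by_contra hne
  have hpos : 0 < ‖σ y - y‖ := norm_pos_iff.2 (sub_ne_zero.2 hne)
  obtain ⟨k, hk⟩ := pow_unbounded_of_one_lt ((1 + ‖-t ^ 2‖) / ‖σ y - y‖) hs
  rw [div_lt_iff₀ hpos, ← hstep] at hk
  have hb := (h.iterate k).norm_le_one_add
  have := IsUltrametricDist.norm_add_le_max
    (σ ((quadraticMap (-t ^ 2))^[k] y)) (-(quadraticMap (-t ^ 2))^[k] y)
  rw [norm_neg, hσ, max_self, ← sub_eq_add_neg] at this
  linarith

theorem prePer_subset_totallyPadic {p : ℕ} [Fact p.Prime] (hp : p ≠ 2) {c : ℚ}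
    (hc : 1 < ‖(c : ℚ_[p])‖) (hsq : IsSquare (-(c : ℚ_[p]))) : prePer c ⊆ totallyPadic p := by
  intro α hα
  obtain ⟨s, hs⟩ := hsq
  have hcs : (c : ℚ_[p]) = -s ^ 2 := by linear_combination -hs
  have hs1 : 1 < ‖s‖ := by
    rw [hcs, norm_neg, norm_pow] at hc
    nlinarith [norm_nonneg s]
  refine Splits.of_splits_map (algebraMap ℚ_[p] (PadicAlgCl p)) (IsAlgClosed.splits _) ?_
  intro β hβ
  have hβ0 : aeval β (minpoly ℚ α) = 0 := by
    have := (mem_roots'.1 hβ).2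
    rw [IsRoot.def, Polynomial.map_map, eval_map,
      Subsingleton.elim ((algebraMap ℚ_[p] (PadicAlgCl p)).comp (algebraMap ℚ ℚ_[p]))
        (algebraMap ℚ (PadicAlgCl p))] at this
    exact this
  have hpre := IsPreperiodicPt.of_aeval_minpoly hα hβ0
  have hcK : algebraMap ℚ (PadicAlgCl p) c = -(algebraMap ℚ_[p] (PadicAlgCl p) s) ^ 2 := by
    rw [← map_pow, ← map_neg, ← hcs, eq_ratCast, map_ratCast]
  rw [hcK] at hpre
  exact (InfiniteGalois.mem_range_algebraMap_iff_fixed β).2 fun σ => hpre.galois_fixed hp hs1 σ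

/-- If `prePer c` were finite, the surjection `f : prePer c → prePer c` would be injective; since
`f x = f (-x)`, only `0` could be preperiodic, so `0` would be a fixed point. -/
theorem infinite_prePer {c : ℚ} (hc : c ≠ 0) : (prePer c).Infinite := by
  set K := AlgebraicClosure ℚ
  set a : K := algebraMap ℚ K c with ha
  have ha0 : a ≠ 0 := by simpa [ha] using hc
  have hneg : ∀ x ∈ prePer c, -x ∈ prePer c := fun x hx => by
    have h1 : IsPreperiodicPt (quadraticMap a) (quadraticMap a x) :=
      (mem_prePer_iff.1 hx).iterate 1
    refine IsPreperiodicPt.of_apply (f := quadraticMap a) ?_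
    rwa [show quadraticMap a (-x) = quadraticMap a x by simp [quadraticMap]]
  intro hfin
  have hsurj : Set.SurjOn (quadraticMap a) (prePer c) (prePer c) := fun w hw => by
    obtain ⟨z, hz⟩ := IsAlgClosed.exists_pow_nat_eq (w - a) two_pos
    have hzw : quadraticMap a z = w := by simp [quadraticMap, hz]
    exact ⟨z, IsPreperiodicPt.of_apply (f := quadraticMap a) (by rw [hzw]; exact hw), hzw⟩
  have hmaps : Set.MapsTo (quadraticMap a) (prePer c) (prePer c) := fun x hx =>
    (mem_prePer_iff.1 hx).iterate 1
  have hinj : Set.InjOn (quadraticMap a) (prePer c) :=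
    ((hfin.surjOn_iff_bijOn_of_mapsTo hmaps).1 hsurj).injOn
  have hzero : ∀ x ∈ prePer c, x = 0 := fun x hx => by
    have := hinj hx (hneg x hx) (by simp [quadraticMap])
    exact self_eq_neg.1 this
  obtain ⟨x, hx⟩ : ∃ x, quadraticMap a x = x := by
    obtain ⟨x, hx⟩ := IsAlgClosed.exists_root (X ^ 2 - X + C a : K[X]) (by
      rw [show (X ^ 2 - X + C a : K[X]) = C 1 * X ^ 2 + C (-1) * X + C a by simp; ring,
        degree_quadratic one_ne_zero]
      norm_num)
    refine ⟨x, ?_⟩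
    simp only [IsRoot.def, eval_add, eval_sub, eval_pow, eval_X, eval_C] at hx
    rw [quadraticMap]; linear_combination hx
  have hx0 := hzero x ⟨0, 1, one_pos, hx⟩
  rw [hx0] at hx
  exact ha0 (by simpa [quadraticMap] using hx)

/-! ### Vandermonde determinants -/

/-- A bound for a Vandermonde determinant from monic polynomials `P j` of degree `j` that are small
on its nodes: the determinant is unchanged when the powers are replaced by the `P j`. -/
theorem norm_det_vandermonde_le {K : Type*} [NormedField K] {N : ℕ} (v : Fin N → K)
    (P : ℕ → K[X]) (hm : ∀ j, (P j).Monic) (hd : ∀ j, (P j).natDegree = j) (B : ℕ → ℝ)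
    (hB : ∀ j < N, ∀ i, ‖(P j).eval (v i)‖ ≤ B j) :
    ‖(Matrix.vandermonde v).det‖ ≤ N.factorial * ∏ j ∈ Finset.range N, B j := by
  rw [Matrix.det_eval_matrixOfPolynomials_eq_det_vandermonde v (fun j => P j) (fun j => hd j)
    (fun j => hm j), Matrix.det_apply']
  refine (norm_sum_le _ _).trans ?_
  have hterm : ∀ σ ∈ (Finset.univ : Finset (Equiv.Perm (Fin N))),
      ‖((Equiv.Perm.sign σ : ℤ) : K) * ∏ i, Matrix.of (fun i j : Fin N => (P j).eval (v i)) (σ i) i‖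
        ≤ ∏ j ∈ Finset.range N, B j := by
    intro σ _
    have hs : ‖((Equiv.Perm.sign σ : ℤ) : K)‖ = 1 := by
      rcases Int.units_eq_one_or (Equiv.Perm.sign σ) with h | h <;> simp [h]
    rw [norm_mul, hs, one_mul, norm_prod, ← Fin.prod_univ_eq_prod_range]
    exact Finset.prod_le_prod (fun _ _ => norm_nonneg _) fun i _ => hB i i.2 (σ i)
  refine (Finset.sum_le_sum hterm).trans ?_
  rw [Finset.sum_const, Finset.card_univ, Fintype.card_perm, Fintype.card_fin, nsmul_eq_mul]

theorem map_det_vandermonde {R S : Type*} [CommRing R] [CommRing S] (φ : R →+* S) {N : ℕ}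
    (v : Fin N → R) : φ (Matrix.vandermonde v).det = (Matrix.vandermonde (φ ∘ v)).det := by
  simp [Matrix.det_vandermonde, map_prod]

/-- The square of a Vandermonde determinant does not depend on the order of the nodes. -/
theorem det_vandermonde_comp_perm_sq {R : Type*} [CommRing R] {N : ℕ} (v : Fin N → R)
    (π : Equiv.Perm (Fin N)) :
    (Matrix.vandermonde (v ∘ π)).det ^ 2 = (Matrix.vandermonde v).det ^ 2 := by
  have : Matrix.vandermonde (v ∘ π) = (Matrix.vandermonde v).submatrix π id := rfl
  rw [this, Matrix.det_permute, mul_pow]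
  rcases Int.units_eq_one_or (Equiv.Perm.sign π) with h | h <;> simp [h]

/-! ### Bases of polynomials that are small on the nodes -/

/-- The monic polynomial of degree `j` obtained as the product of the iterates of `x ^ 2 + c` over
the positions of the binary digits `1` of `j`. -/
noncomputable def digitPoly {R : Type*} [CommRing R] (c : R) (j : ℕ) : R[X] :=
  ∏ k ∈ j.bitIndices.toFinset, iterPoly c k

theorem digitPoly_monic {R : Type*} [CommRing R] [Nontrivial R] (c : R) (j : ℕ) :
    (digitPoly c j).Monic :=
  monic_prod_of_monic _ _ fun k _ => (iterPoly_monic_natDegree c k).1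

theorem natDegree_digitPoly {R : Type*} [CommRing R] [Nontrivial R] (c : R) (j : ℕ) :
    (digitPoly c j).natDegree = j := by
  rw [digitPoly, natDegree_prod_of_monic _ _ fun k _ => (iterPoly_monic_natDegree c k).1]
  simp [(iterPoly_monic_natDegree c _).2]

theorem eval_digitPoly {R : Type*} [CommRing R] (c x : R) (j : ℕ) :
    (digitPoly c j).eval x = ∏ k ∈ j.bitIndices.toFinset, (quadraticMap c)^[k] x := by
  rw [digitPoly, eval_prod]
  exact Finset.prod_congr rfl fun k _ => by
    rw [← coe_aeval_eq_eval, aeval_iterPoly, Algebra.algebraMap_self_apply]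

theorem card_bitIndices_le {j L : ℕ} (h : j < 2 ^ L) : j.bitIndices.toFinset.card ≤ L := by
  have : j.bitIndices.toFinset ⊆ Finset.range L := fun k hk => by
    rw [Finset.mem_range]
    exact (Nat.pow_lt_pow_iff_right one_lt_two).1
      ((Nat.two_pow_le_of_mem_bitIndices (List.mem_toFinset.1 hk)).trans_lt h)
  simpa using Finset.card_le_card this

theorem norm_eval_digitPoly_le {K : Type*} [NormedField K] {c x : K}
    (h : IsPreperiodicPt (quadraticMap c) x) {j L : ℕ} (hj : j < 2 ^ L) :
    ‖(digitPoly c j).eval x‖ ≤ (1 + ‖c‖) ^ L := by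
  rw [eval_digitPoly, norm_prod]
  calc _ ≤ ∏ _k ∈ j.bitIndices.toFinset, (1 + ‖c‖) :=
        Finset.prod_le_prod (fun _ _ => norm_nonneg _) fun k _ => (h.iterate k).norm_le_one_add
    _ ≤ _ := by
        rw [Finset.prod_const]
        exact pow_le_pow_right₀ (by linarith [norm_nonneg c]) (card_bitIndices_le hj)

theorem isIntegral_pow_mul_eval_digitPoly {c : ℚ} {K : Type*} [Field K] [CharZero K] {x : K}
    (h : IsPreperiodicPt (quadraticMap (c : K)) x) {j L : ℕ} (hj : j < 2 ^ L) :
    IsIntegral ℤ ((c.den : K) ^ L * (digitPoly (c : K) j).eval x) := by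
  rw [eval_digitPoly, ← Nat.sub_add_cancel (card_bitIndices_le hj), pow_add, mul_assoc,
    ← Finset.prod_const, ← Finset.prod_mul_distrib]
  have hden : IsIntegral ℤ (c.den : K) := by
    simpa using isIntegral_algebraMap (R := ℤ) (A := K) (x := (c.den : ℤ))
  exact (hden.pow _).mul
    (IsIntegral.prod _ fun k _ => (h.iterate k).isIntegral_den_mul)

/-- A monic polynomial of degree `j` divisible by `(X ^ p - X) ^ (j / p)`, hence with values in
`p ^ (j / p) * ℤ_[p]` on `ℤ_[p]`. -/
noncomputable def frobeniusPoly (R : Type*) [CommRing R] (p j : ℕ) : R[X] :=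
  (X ^ p - X) ^ (j / p) * X ^ (j % p)

theorem frobeniusPoly_monic_natDegree (R : Type*) [CommRing R] [Nontrivial R] {p : ℕ} (hp : 1 < p)
    (j : ℕ) : (frobeniusPoly R p j).Monic ∧ (frobeniusPoly R p j).natDegree = j := by
  have hlt : (X : R[X]).degree < ((X : R[X]) ^ p).degree := by
    rw [degree_X_pow, degree_X]; exact_mod_cast hp
  have hm : ((X : R[X]) ^ p - X).Monic := (monic_X_pow p).sub_of_left hlt
  have hd : ((X : R[X]) ^ p - X).natDegree = p := by
    rw [natDegree_sub_eq_left_of_natDegree_lt (by simpa using hp), natDegree_X_pow]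
  refine ⟨(hm.pow _).mul (monic_X_pow _), ?_⟩
  rw [frobeniusPoly, (hm.pow _).natDegree_mul (monic_X_pow _), hm.natDegree_pow, hd,
    natDegree_X_pow, mul_comm]
  exact Nat.div_add_mod j p

theorem PadicInt.norm_pow_sub_self_le {p : ℕ} [Fact p.Prime] (z : ℤ_[p]) :
    ‖z ^ p - z‖ ≤ (p : ℝ)⁻¹ := by
  have h : z ^ p - z ∈ RingHom.ker (PadicInt.toZMod (p := p)) := by
    rw [RingHom.mem_ker, map_sub, map_pow, ZMod.pow_card, sub_self]
  rw [PadicInt.ker_toZMod, PadicInt.maximalIdeal_eq_span_p] at h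
  have := (PadicInt.norm_le_pow_iff_mem_span_pow (z ^ p - z) 1).2 (by simpa using h)
  simpa using this

theorem norm_eval_frobeniusPoly_le {p : ℕ} [Fact p.Prime] {y : ℚ_[p]} (hy : ‖y‖ ≤ 1) (j : ℕ) :
    ‖(frobeniusPoly ℚ_[p] p j).eval y‖ ≤ (p : ℝ)⁻¹ ^ (j / p) := by
  have h : ‖y ^ p - y‖ ≤ (p : ℝ)⁻¹ := PadicInt.norm_pow_sub_self_le ⟨y, hy⟩
  simp only [frobeniusPoly, eval_mul, eval_pow, eval_sub, eval_X, norm_mul, norm_pow]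
  calc _ ≤ ((p : ℝ)⁻¹) ^ (j / p) * 1 := by
        gcongr
        exact pow_le_one₀ (norm_nonneg _) hy
    _ = _ := mul_one _

theorem sq_le_sum_div {p : ℕ} (hp : 0 < p) (N : ℕ) :
    N ^ 2 ≤ 2 * p * ∑ j ∈ Finset.range N, j / p + 2 * p * N := by
  induction N with
  | zero => simp
  | succ N ih =>
    rw [Finset.sum_range_succ]
    have := Nat.lt_mul_div_succ N hp
    nlinarith

theorem Int.one_le_abs_mul_padic_norm {p : ℕ} [Fact p.Prime] {M : ℤ} (hM : M ≠ 0) :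
    1 ≤ |(M : ℝ)| * ‖(M : ℚ_[p])‖ := by
  have hp : (0 : ℝ) < p := by exact_mod_cast (Fact.out : p.Prime).pos
  have hM' : (M : ℚ_[p]) ≠ 0 := by exact_mod_cast hM
  rw [Padic.norm_eq_zpow_neg_valuation hM']
  have hv : (M : ℚ_[p]).valuation = (padicValInt p M : ℤ) := Padic.valuation_intCast M
  rw [hv, zpow_neg, zpow_natCast, ← div_eq_mul_inv, one_le_div (pow_pos hp _)]
  have h := Int.le_of_dvd (abs_pos.2 hM) ((dvd_abs _ _).2 (padicValInt_dvd (p := p) M))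
  exact_mod_cast h

/-! ### Finiteness for `‖c‖ ≤ 1` -/

/-- For a Galois-stable set of `N` totally `p`-adic preperiodic points with Vandermonde determinant
`V`, the number `(c.den ^ (L * N) * V) ^ 2` is a nonzero integer, so the product of its absolute
value and its `p`-adic norm is at least one. The iterates of `f` bound the former and the
polynomials divisible by powers of `X ^ p - X` bound the latter. -/
theorem pow_sum_div_le {p : ℕ} [Fact p.Prime] {c : ℚ} (hc : ‖(c : ℚ_[p])‖ ≤ 1) {N L : ℕ}
    (hL : N ≤ 2 ^ L) (v : Fin N → AlgebraicClosure ℚ) (hinj : Function.Injective v)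
    (hv : ∀ i, v i ∈ prePer c ∩ totallyPadic p)
    (hstab : ∀ σ : AlgebraicClosure ℚ ≃ₐ[ℚ] AlgebraicClosure ℚ, ∀ i, σ (v i) ∈ Set.range v) :
    (p : ℝ) ^ (∑ j ∈ Finset.range N, j / p) ≤
      (N.factorial : ℝ) ^ 2 * ((c.den * (1 + ‖(c : ℂ)‖)) ^ L) ^ N := by
  have hpre : ∀ i, IsPreperiodicPt (quadraticMap (c : AlgebraicClosure ℚ)) (v i) := fun i => by
    rw [← eq_ratCast (algebraMap ℚ (AlgebraicClosure ℚ)) c]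
    exact mem_prePer_iff.1 (hv i).1
  have hpreK : ∀ {K : Type} [Field K] [CharZero K] (φ : AlgebraicClosure ℚ →+* K) (i : Fin N),
      IsPreperiodicPt (quadraticMap (c : K)) (φ (v i)) := fun φ i => by
    simpa using (hpre i).map φ
  set V := (Matrix.vandermonde v).det with hV
  set W : AlgebraicClosure ℚ := (((c.den : AlgebraicClosure ℚ) ^ L) ^ N * V) ^ 2 with hW
  have hV0 : V ≠ 0 := Matrix.det_vandermonde_ne_zero_iff.2 hinj
  have hden : (c.den : AlgebraicClosure ℚ) ≠ 0 := by exact_mod_cast c.den_ne_zero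
  have hW0 : W ≠ 0 := pow_ne_zero _ (mul_ne_zero (pow_ne_zero _ (pow_ne_zero _ hden)) hV0)
  have hWint : IsIntegral ℤ W := by
    refine IsIntegral.pow ?_ 2
    have := Matrix.det_smul
      (Matrix.of fun i j : Fin N => (digitPoly (c : AlgebraicClosure ℚ) j).eval (v i))
      ((c.den : AlgebraicClosure ℚ) ^ L)
    rw [Fintype.card_fin, ← Matrix.det_eval_matrixOfPolynomials_eq_det_vandermonde v
      (fun j => digitPoly (c : AlgebraicClosure ℚ) j) (fun j => natDegree_digitPoly _ j)
      (fun j => digitPoly_monic _ j)] at this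
    rw [hV, ← this]
    exact IsIntegral.det fun i j =>
      isIntegral_pow_mul_eval_digitPoly (hpre i) (j.2.trans_le hL)
  have hWfix : ∀ σ : AlgebraicClosure ℚ ≃ₐ[ℚ] AlgebraicClosure ℚ, σ W = W := by
    intro σ
    choose g hg using hstab σ
    have hginj : Function.Injective g := fun i j hij =>
      hinj (σ.injective (by rw [← hg, ← hg, hij]))
    let π : Equiv.Perm (Fin N) := Equiv.ofBijective g (Finite.injective_iff_bijective.1 hginj)
    have hσv : (σ : AlgebraicClosure ℚ →+* AlgebraicClosure ℚ) ∘ v = v ∘ π :=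
      funext fun i => (hg i).symm
    have hσV : σ V = (Matrix.vandermonde (v ∘ π)).det := by
      rw [← hσv]
      exact map_det_vandermonde (σ : AlgebraicClosure ℚ →+* AlgebraicClosure ℚ) v
    rw [hW, map_pow, map_mul, map_pow, map_pow, map_natCast, mul_pow, mul_pow, hσV,
      det_vandermonde_comp_perm_sq]
  obtain ⟨q, hq⟩ := (InfiniteGalois.mem_range_algebraMap_iff_fixed W).2 hWfix
  obtain ⟨M, hM⟩ : ∃ M : ℤ, algebraMap ℤ ℚ M = q := by
    refine IsIntegrallyClosed.isIntegral_iff.1 ?_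
    rw [← hq] at hWint
    exact (isIntegral_algebraMap_iff (algebraMap ℚ (AlgebraicClosure ℚ)).injective).1 hWint
  have hWM : W = (M : AlgebraicClosure ℚ) := by rw [← hq, ← hM]; simp
  have hM0 : M ≠ 0 := by rintro rfl; exact hW0 (by simpa using hWM)
  have hnorm : ∀ {K : Type} [NormedField K] [CharZero K] (φ : AlgebraicClosure ℚ →+* K),
      ‖(M : K)‖ = ((‖(c.den : K)‖ ^ L) ^ N * ‖(Matrix.vandermonde (φ ∘ v)).det‖) ^ 2 := by
    intro K _ _ φ
    rw [← map_det_vandermonde φ v, ← hV, ← norm_pow, ← norm_pow, ← norm_mul, ← norm_pow,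
      ← map_intCast φ, ← hWM, hW]
    simp
  -- The archimedean bound.
  let φ : AlgebraicClosure ℚ →+* ℂ := (IsAlgClosed.lift : AlgebraicClosure ℚ →ₐ[ℚ] ℂ)
  have harch : |(M : ℝ)| ≤
      (N.factorial * ((c.den * (1 + ‖(c : ℂ)‖)) ^ L) ^ N) ^ 2 := by
    have hdet := norm_det_vandermonde_le (φ ∘ v) (digitPoly (c : ℂ)) (digitPoly_monic _)
      (natDegree_digitPoly _) (fun _ => (1 + ‖(c : ℂ)‖) ^ L)
      fun j hj i => norm_eval_digitPoly_le (hpreK φ i) (hj.trans_le hL)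
    rw [Finset.prod_const, Finset.card_range] at hdet
    have h1 := hnorm φ
    rw [Complex.norm_intCast] at h1
    rw [h1, Complex.norm_natCast, mul_pow (c.den : ℝ), mul_pow ((c.den : ℝ) ^ L),
      mul_left_comm]
    gcongr
  -- The `p`-adic bound.
  let ψ : AlgebraicClosure ℚ →+* PadicAlgCl p :=
    (IsAlgClosed.lift : AlgebraicClosure ℚ →ₐ[ℚ] PadicAlgCl p)
  have hpadic : ‖(M : ℚ_[p])‖ ≤
      (N.factorial * ((p : ℝ) ^ (∑ j ∈ Finset.range N, j / p))⁻¹) ^ 2 := by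
    choose y hy using fun i => map_mem_range_of_mem_totallyPadic (hv i).2 ψ
    have hy1 : ∀ i, ‖y i‖ ≤ 1 := fun i => by
      rw [← PadicAlgCl.norm_extends, hy]
      refine (hpreK ψ i).norm_le_one ?_
      rwa [← map_ratCast (algebraMap ℚ_[p] (PadicAlgCl p)), PadicAlgCl.norm_extends]
    have hdet := norm_det_vandermonde_le y (frobeniusPoly ℚ_[p] p)
      (fun j => (frobeniusPoly_monic_natDegree _ (Fact.out : p.Prime).one_lt j).1)
      (fun j => (frobeniusPoly_monic_natDegree _ (Fact.out : p.Prime).one_lt j).2)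
      (fun j => (p : ℝ)⁻¹ ^ (j / p)) fun j _ i => norm_eval_frobeniusPoly_le (hy1 i) j
    rw [Finset.prod_pow_eq_pow_sum, inv_pow] at hdet
    have hψv : ψ ∘ v = algebraMap ℚ_[p] (PadicAlgCl p) ∘ y := funext fun i => (hy i).symm
    have hMn : ‖(M : ℚ_[p])‖ = ‖(M : PadicAlgCl p)‖ := by
      rw [← PadicAlgCl.norm_extends, map_intCast]
    have hdn : ‖(c.den : PadicAlgCl p)‖ ≤ 1 := by
      rw [← map_natCast (algebraMap ℚ_[p] (PadicAlgCl p)), PadicAlgCl.norm_extends]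
      exact_mod_cast Padic.norm_int_le_one (p := p) c.den
    rw [hMn, hnorm ψ, hψv, ← map_det_vandermonde, PadicAlgCl.norm_extends]
    have hpow : (‖(c.den : PadicAlgCl p)‖ ^ L) ^ N ≤ 1 :=
      pow_le_one₀ (by positivity) (pow_le_one₀ (norm_nonneg _) hdn)
    exact pow_le_pow_left₀ (by positivity)
      ((mul_le_of_le_one_left (norm_nonneg _) hpow).trans hdet) 2
  have hp0 : (0 : ℝ) < (p : ℝ) ^ (∑ j ∈ Finset.range N, j / p) :=
    pow_pos (by exact_mod_cast (Fact.out : p.Prime).pos) _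
  have hle : (1 : ℝ) ≤ ((N.factorial * ((c.den * (1 + ‖(c : ℂ)‖)) ^ L) ^ N) *
      (N.factorial * ((p : ℝ) ^ (∑ j ∈ Finset.range N, j / p))⁻¹)) ^ 2 := by
    rw [mul_pow]
    exact (Int.one_le_abs_mul_padic_norm hM0).trans
      (mul_le_mul harch hpadic (norm_nonneg _) (by positivity))
  have hle' := (one_le_sq_iff₀ (by positivity)).1 hle
  rw [← mul_assoc, ← div_eq_mul_inv, one_le_div hp0] at hle'
  linarith

/-- The inequality of `pow_sum_div_le` fails for large `N`, its left side growing like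
`p ^ (N ^ 2 / (2 * p))` and its right side like `N ^ (const * N)`. -/
theorem exists_forall_lt_pow_sum_div {p : ℕ} (hp : 1 < p) (B : ℝ) (hB : 0 ≤ B) :
    ∃ N₀ : ℕ, ∀ N, N₀ ≤ N → ∃ L, N ≤ 2 ^ L ∧
      (N.factorial : ℝ) ^ 2 * (B ^ L) ^ N < (p : ℝ) ^ (∑ j ∈ Finset.range N, j / p) := by
  obtain ⟨a, ha⟩ := pow_unbounded_of_one_lt B (one_lt_two : (1 : ℝ) < 2)
  have hp1 : (1 : ℝ) < p := by exact_mod_cast hp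
  set d := (2 + a) * (2 * p)
  set K : ℝ := (p : ℝ) ^ (2 * p) * 2 ^ (a * (2 * p)) with hK
  have hK0 : 0 < K := by positivity
  have hev := (tendsto_pow_const_div_const_pow_of_one_lt d hp1).eventually
    (gt_mem_nhds (inv_pos.2 hK0))
  obtain ⟨N₀, hN₀⟩ := Filter.eventually_atTop.1 hev
  refine ⟨max N₀ 1, fun N hN => ⟨Nat.log 2 N + 1, (Nat.lt_pow_succ_log_self one_lt_two N).le, ?_⟩⟩
  have hN1 : 1 ≤ N := (le_max_right _ _).trans hN
  have hlt := hN₀ N ((le_max_left _ _).trans hN)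
  rw [div_lt_iff₀ (by positivity), ← div_eq_inv_mul, lt_div_iff₀' hK0] at hlt
  set E := ∑ j ∈ Finset.range N, j / p
  have hBL : B ^ (Nat.log 2 N + 1) ≤ (2 * N : ℝ) ^ a := by
    have h2 : (2 : ℝ) ^ (Nat.log 2 N + 1) ≤ 2 * N := by
      rw [pow_succ']
      exact_mod_cast Nat.mul_le_mul_left 2 (Nat.pow_log_le_self 2 (by omega))
    calc B ^ (Nat.log 2 N + 1) ≤ (2 ^ a) ^ (Nat.log 2 N + 1) := by gcongr
      _ = (2 ^ (Nat.log 2 N + 1)) ^ a := pow_right_comm _ _ _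
      _ ≤ _ := by gcongr
  have hfac : (N.factorial : ℝ) ≤ (N : ℝ) ^ N := by exact_mod_cast Nat.factorial_le_pow N
  by_contra! hcon
  have h1 : (p : ℝ) ^ E ≤ ((N : ℝ) ^ 2 * (2 * N) ^ a) ^ N := by
    calc (p : ℝ) ^ E ≤ _ := hcon
      _ ≤ ((N : ℝ) ^ N) ^ 2 * ((2 * N : ℝ) ^ a) ^ N := by gcongr
      _ = _ := by rw [pow_right_comm, ← mul_pow]
  have h2 : ((p : ℝ) ^ N) ^ N ≤ (K * N ^ d) ^ N := by
    calc ((p : ℝ) ^ N) ^ N = (p : ℝ) ^ N ^ 2 := by rw [← pow_mul, sq]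
      _ ≤ (p : ℝ) ^ (2 * p * E + 2 * p * N) :=
          pow_le_pow_right₀ hp1.le (sq_le_sum_div (by omega) N)
      _ = ((p : ℝ) ^ E) ^ (2 * p) * ((p : ℝ) ^ (2 * p)) ^ N := by
          rw [pow_add, mul_comm (2 * p) E, pow_mul, pow_mul _ (2 * p) N]
      _ ≤ (((N : ℝ) ^ 2 * (2 * N) ^ a) ^ N) ^ (2 * p) * ((p : ℝ) ^ (2 * p)) ^ N := by gcongr
      _ = _ := by
          rw [pow_right_comm, ← mul_pow]
          congr 1
          simp only [hK, d, mul_pow, ← pow_mul, add_mul, pow_add]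
          ring
  exact absurd ((pow_le_pow_iff_left₀ (by positivity) (by positivity) (by omega)).1 h2)
    (not_le.2 hlt)

theorem finite_prePer_inter_totallyPadic {p : ℕ} [Fact p.Prime] {c : ℚ}
    (hc : ‖(c : ℚ_[p])‖ ≤ 1) : (prePer c ∩ totallyPadic p).Finite := by
  by_contra hinf
  obtain ⟨N₀, hN₀⟩ := exists_forall_lt_pow_sum_div (Fact.out : p.Prime).one_lt
    (c.den * (1 + ‖(c : ℂ)‖)) (by positivity)
  obtain ⟨t, htT, htc⟩ := Set.Infinite.exists_subset_card_eq hinf N₀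
  -- The closure of `t` under conjugation.
  have hSfin : (⋃ α ∈ t, (minpoly ℚ α).rootSet (AlgebraicClosure ℚ)).Finite :=
    t.finite_toSet.biUnion fun α _ => rootSet_finite _ _
  set S := hSfin.toFinset with hS
  have hmem : ∀ β, β ∈ S ↔ ∃ α ∈ t, aeval β (minpoly ℚ α) = 0 := fun β => by
    simp only [hS, Set.Finite.mem_toFinset, Set.mem_iUnion, exists_prop]
    refine exists_congr fun α => and_congr_right fun _ => ?_
    rw [mem_rootSet_of_ne (minpoly.ne_zero (Algebra.IsIntegral.isIntegral α))]
  have hcard : N₀ ≤ S.card := by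
    rw [← htc]
    exact Finset.card_le_card fun α hα => (hmem α).2 ⟨α, hα, minpoly.aeval ℚ α⟩
  let v : Fin S.card → AlgebraicClosure ℚ := fun i => S.equivFin.symm i
  have hvS : ∀ i, v i ∈ S := fun i => (S.equivFin.symm i).2
  have hT : ∀ β ∈ S, β ∈ prePer c ∩ totallyPadic p := fun β hβ => by
    obtain ⟨α, hα, h⟩ := (hmem β).1 hβ
    refine ⟨mem_prePer_iff.2 (IsPreperiodicPt.of_aeval_minpoly (htT hα).1 h), ?_⟩
    have hint := Algebra.IsIntegral.isIntegral (R := ℚ) α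
    have : minpoly ℚ α = minpoly ℚ β :=
      minpoly.eq_of_irreducible_of_monic (minpoly.irreducible hint) h (minpoly.monic hint)
    have htp := (htT hα).2
    rwa [totallyPadic, Set.mem_ofPred_eq, this] at htp
  obtain ⟨L, hL, hlt⟩ := hN₀ S.card hcard
  refine absurd (pow_sum_div_le hc hL v (fun i j h => S.equivFin.symm.injective (Subtype.ext h))
    (fun i => hT _ (hvS i)) fun σ i => ?_) (not_le.2 hlt)
  obtain ⟨α, hα, h⟩ := (hmem _).1 (hvS i)
  have hσ : σ (v i) ∈ S := (hmem _).2 ⟨α, hα, by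
    have := aeval_algHom_apply (σ : AlgebraicClosure ℚ →ₐ[ℚ] AlgebraicClosure ℚ) (v i) (minpoly ℚ α)
    rw [h, map_zero] at this
    exact this⟩
  exact ⟨S.equivFin ⟨_, hσ⟩, by simp [v]⟩

theorem theorem5p2 (p : ℕ) [Fact p.Prime] (hp : p ≠ 2) (c : ℚ) :
    (‖(c : ℚ_[p])‖ ≤ 1 → (prePer c ∩ totallyPadic p).Finite) ∧
    (1 < ‖(c : ℚ_[p])‖ → ¬ IsSquare (-(c : ℚ_[p])) → prePer c ∩ totallyPadic p = ∅) ∧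
    (1 < ‖(c : ℚ_[p])‖ → IsSquare (-(c : ℚ_[p])) →
      prePer c ⊆ totallyPadic p ∧ (prePer c ∩ totallyPadic p).Infinite) := by
  refine ⟨finite_prePer_inter_totallyPadic, prePer_inter_totallyPadic_eq_empty hp,
    fun hc hsq => ?_⟩
  have hsub := prePer_subset_totallyPadic hp hc hsq
  refine ⟨hsub, ?_⟩
  rw [Set.inter_eq_left.2 hsub]
  exact infinite_prePer (by rintro rfl; norm_num at hc)
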